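/- Consider a MIMO two-way full-duplex channel with two nodes, each with $M$ transmit and $N$ receive antennas: channel matrices $H_{ij}\in\mathbb{C}^{N\times M}$ and power gains $\eta_{ij}\ge 0$ from node $i$ to node $j$ ($i,j\in\{1,2\}$), a transmit front-end noise level $\beta\ge 0$, and transmit power budgets $P_1,P_2\ge 0$. Let $$\mathcal{X}_i=\{Q\in\mathbb{C}^{M\times M} : Q=Q^\dagger,\ Q\succeq 0,\ \operatorname{tr}(Q)\le P_i\},$$ for $Q_j\in\mathcal{X}_j$ let $\Sigma_j(Q_j)=I+\beta\eta_{jj}H_{jj}\operatorname{diag}(Q_j)H_{jj}^\dagger$, where $\operatorname{diag}(Q_j)$ is the diagonal matrix with the same diagonal as $Q_j$, and for $i\ne j$ let $$R_i(Q_i,Q_j)=\log\det\bigl(I+\eta_{ij}H_{ij}^\dagger\Sigma_j(Q_j)^{-1}H_{ij}Q_i\bigr)$$ be the rate of node $i$. A pair $(Q_1^*,Q_2^*)\in\mathcal{X}_1\times\mathcal{X}_2$ is a Nash equilibrium if $R_i(Q_i^*,Q_j^*)\ge R_i(Q_i,Q_j^*)$ for all $Q_i\in\mathcal{X}_i$ and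 all $i\neq j$. A best-response function of node $i$ is a map $\mathcal{B}_i:\mathcal{X}_j\to\mathcal{X}_i$ such that, for every $Q_j\in\mathcal{X}_j$, $\mathcal{B}_i(Q_j)$ maximizes $R_i(\cdot,Q_j)$ over $\mathcal{X}_i$; a best-response (water-filling) mapping is a map $\Phi$ on $\mathcal{X}_1\times\mathcal{X}_2$ of the form $\Phi(Q_1,Q_2)=(\mathcal{B}_1(Q_2),\mathcal{B}_2(Q_1))$ with best-response functions $\mathcal{B}_1,\mathcal{B}_2$. Then, for all such data, there exists at least one Nash equilibrium, and there is a best-response mapping $\Phi$ that has a fixed point. Moreover, if the direct channels do not vanish, i.e. $\eta_{12}H_{12}\ne 0$ and $\eta_{21}H_{21}\ne 0$, then there is exactly one best-response mapping $\Phi$, its fixed points are exactly the Nash equilibria, and it has at least one fixed point. -/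

import Mathlib

open scoped Matrix ComplexOrder

/-- A MIMO two-way full-duplex channel: two nodes (indexed by `0` and `1`), each with `M` transmit
and `N` receive antennas. -/
structure FDChannel (M N : ℕ) where
  /-- `H i j` is the channel matrix from the transmitter of node `i` to the receiver of node `j`
  (self-interference channel for `i = j`). -/
  H : Fin 2 → Fin 2 → Matrix (Fin N) (Fin M) ℂ
  /-- average power gains -/
  η : Fin 2 → Fin 2 → ℝ
  /-- transmit front-end noise level -/
  β : ℝ
  /-- transmit power budgets -/
  P : Fin 2 → ℝ
  η_nonneg : ∀ i j, 0 ≤ η i j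
  β_nonneg : 0 ≤ β
  P_nonneg : ∀ i, 0 ≤ P i

namespace FDChannel

variable {M N : ℕ} (C : FDChannel M N)

/-- The feasible transmit covariance matrices of node `i`: positive semidefinite Hermitian matrices
of trace at most `P i`. -/
def feasible (i : Fin 2) : Set (Matrix (Fin M) (Fin M) ℂ) :=
  {Q | Q.PosSemidef ∧ Q.trace.re ≤ C.P i}

/-- Covariance of the residual self-interference plus thermal noise at receiver `j`, when node `j`
transmits with covariance `Qj`. -/
noncomputable def noiseCov (j : Fin 2) (Qj : Matrix (Fin M) (Fin M) ℂ) :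
    Matrix (Fin N) (Fin N) ℂ :=
  1 + ((C.β * C.η j j : ℝ) : ℂ) • (C.H j j * Matrix.diagonal Qj.diag * (C.H j j)ᴴ)

/-- Rate of the transmission from node `i` to node `j`, the payoff of node `i`. For feasible
covariances the noise covariance is positive definite and the determinant is a real number that is
at least `1`, so that neither the matrix inverse, nor the real part, nor the logarithm
is a junk value. -/
noncomputable def rate (i j : Fin 2) (Qi Qj : Matrix (Fin M) (Fin M) ℂ) : ℝ :=
  Real.log (Matrix.det
    (1 + (C.η i j : ℂ) • ((C.H i j)ᴴ * (C.noiseCov j Qj)⁻¹ * C.H i j * Qi))).re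

/-- Nash equilibrium (competitive optimality): a feasible pair of strategies such that neither node
can increase its own rate by a unilateral change of strategy. -/
def IsNashEquilibrium (Q : C.feasible 0 × C.feasible 1) : Prop :=
  (∀ Q₁ ∈ C.feasible 0, C.rate 0 1 Q₁ Q.2 ≤ C.rate 0 1 Q.1 Q.2) ∧
  (∀ Q₂ ∈ C.feasible 1, C.rate 1 0 Q₂ Q.1 ≤ C.rate 1 0 Q.2 Q.1)

/-- `B` is a best-response function of node `i` against node `j`: `B Qj` is an optimal solution of
the maximization of the rate of node `i` over its feasible set, given `Qj`. -/
def IsBestResponse (i j : Fin 2) (B : C.feasible j → C.feasible i) : Prop :=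
  ∀ Qj : C.feasible j, ∀ Qi ∈ C.feasible i, C.rate i j Qi Qj ≤ C.rate i j (B Qj) Qj

/-- `Φ` is a best-response (water-filling) mapping on the feasible strategy profiles:
`Φ (Q₁, Q₂) = (B₁ Q₂, B₂ Q₁)` for best-response functions `B₁`, `B₂` of the two nodes. -/
def IsBestResponseMap (Φ : C.feasible 0 × C.feasible 1 → C.feasible 0 × C.feasible 1) : Prop :=
  ∃ (B₁ : C.feasible 1 → C.feasible 0) (B₂ : C.feasible 0 → C.feasible 1),
    C.IsBestResponse 0 1 B₁ ∧ C.IsBestResponse 1 0 B₂ ∧ Φ = fun Q => (B₁ Q.2, B₂ Q.1)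

end FDChannel

/-!
A Nash equilibrium is a fixed point of the best-response mapping, and it exists by Brouwer's theorem
once best responses are known to be unique and hence continuous.

*Uniqueness.* For a fixed strategy of the other node, the rate is `log det (1 + G Q)` with a positive
semidefinite matrix `G = Aᴴ A`, and `det (1 + G Q) = det (1 + A Q Aᴴ)`. Strict concavity of `log det`
shows that two maximizers `Q₁`, `Q₂` have the same `A Q Aᴴ`, so that `G (Q₁ - Q₂) G = 0`. If `G ≠ 0`
then a maximizer uses the whole power, as otherwise a multiple of the identity could be added. So
it vanishes on the kernel of `G`, as power spent there could be saved without changing the rate.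
Both facts together give `Q₁ = Q₂` (`Matrix.PosSemidef.maximizer_unique`).

*Continuity.* The feasible sets are compact and the rate is jointly continuous, so that the unique
maximizer depends continuously on the strategy of the other node
(`continuous_of_unique_maximizer`).

*Fixed point.* A strategy of node `0` affects the rate of node `1` through its diagonal only, and the
diagonals of the best responses, divided by the power budget, form points of a standard simplex.
Brouwer's theorem for the simplex (`exists_fixedPoint_stdSimplex`) thus suffices. It is
derived from a combinatorial lemma of Scarf on finite sets with several linear orders
(`exists_colorful_dominant`), a variant of Sperner's lemma that needs no triangulations: the dominant
faces of full dimension play the part of the simplices of a triangulation, as each face of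
codimension one lies in zero or two of them (`even_card_dominant_cofaces`), except on the boundary.

If a node has a vanishing channel or the relevant power budget is zero, then that node is indifferent
between all its strategies, and a best response of the other node gives an equilibrium directly. In
general a best-response function can be changed at one point to any optimal strategy, so
that each equilibrium is a fixed point of some best-response mapping.
-/

/-! ### Scarf's lemma -/

/-- The vertices are the points of `T` and one slack vertex for each index `i : I`. A set `S` of
vertices is a dominant face for the rankings `r i` if no point of `T` is ranked strictly above the
lowest-ranked point of `S` by all those indices whose slack vertex is not in `S`. -/
def IsDominantFace {T I : Type*} (r : I → T → ℕ) (S : Finset (T ⊕ I)) : Prop :=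
  ∀ x, ∃ i, Sum.inr i ∉ S ∧ ∀ y, Sum.inl y ∈ S → r i x ≤ r i y

theorem IsDominantFace.mono {T I : Type*} {r : I → T → ℕ} {S S' : Finset (T ⊕ I)}
    (h : IsDominantFace r S') (hS : S ⊆ S') : IsDominantFace r S := by
  intro x
  obtain ⟨i, hi, hy⟩ := h x
  exact ⟨i, fun h => hi (hS h), fun y h => hy y (hS h)⟩

/-- The number of facets of `S` that carry all colours but `i₀` is one if `S` carries all colours,
and it is zero or two otherwise. -/
theorem card_facets_missing_color_mod_two {V I : Type*} [DecidableEq V] [Fintype I] [DecidableEq I]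
    (c : V → I) (i₀ : I) (S : Finset V) (hS : S.card = Fintype.card I) :
    (S.filter fun v => (S.erase v).image c = Finset.univ.erase i₀).card % 2 =
      if S.image c = Finset.univ then 1 else 0 := by
  split_ifs with h
  · have hinj : Set.InjOn c S := by
      rw [← Finset.card_image_iff, h, hS, Finset.card_univ]
    obtain ⟨v₀, hv₀, hc⟩ : ∃ v ∈ S, c v = i₀ := by
      have : i₀ ∈ S.image c := by simp [h]
      simpa using this
    suffices H : (S.filter fun v => (S.erase v).image c = Finset.univ.erase i₀) = {v₀} by
      rw [H]; simp
    ext v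
    simp only [Finset.mem_filter, Finset.mem_singleton]
    constructor
    · rintro ⟨hv, him⟩
      by_contra hne
      have : i₀ ∈ (S.erase v).image c :=
        Finset.mem_image.2 ⟨v₀, Finset.mem_erase.2 ⟨fun h => hne h.symm, hv₀⟩, hc⟩
      rw [him] at this
      simp at this
    · rintro rfl
      refine ⟨hv₀, ?_⟩
      ext i
      simp only [Finset.mem_image, Finset.mem_erase, Finset.mem_univ, and_true]
      constructor
      · rintro ⟨w, ⟨hw, hwS⟩, rfl⟩ h'
        exact hw (hinj hwS hv₀ (h'.trans hc.symm))
      · intro hi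
        have : i ∈ S.image c := by simp [h]
        obtain ⟨w, hw, rfl⟩ := Finset.mem_image.1 this
        exact ⟨w, ⟨by rintro rfl; exact hi hc, hw⟩, rfl⟩
  · rcases Finset.eq_empty_or_nonempty
      (S.filter fun v => (S.erase v).image c = Finset.univ.erase i₀) with he | ⟨v, hv⟩
    · rw [he]; simp
    obtain ⟨hvS, him⟩ := Finset.mem_filter.1 hv
    have hinj : Set.InjOn c (S.erase v) := by
      rw [← Finset.card_image_iff, him, Finset.card_erase_of_mem hvS,
        Finset.card_erase_of_mem (Finset.mem_univ _), hS, Finset.card_univ]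
    have hmem : ∀ i, i ≠ i₀ ↔ ∃ w, (w ≠ v ∧ w ∈ S) ∧ c w = i := by
      intro i
      have := congrArg (fun s => i ∈ s) him
      simp only [Finset.mem_image, Finset.mem_erase, Finset.mem_univ, and_true] at this
      exact (iff_of_eq this).symm
    have hcv : c v ≠ i₀ := by
      intro hcv
      refine h (Finset.eq_univ_of_forall fun i => Finset.mem_image.2 ?_)
      by_cases hi : i = i₀
      · exact ⟨v, hvS, hcv.trans hi.symm⟩
      · obtain ⟨w, hw, hw'⟩ := (hmem i).1 hi
        exact ⟨w, hw.2, hw'⟩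
    obtain ⟨w, ⟨hwv, hwS⟩, hcw⟩ := (hmem _).1 hcv
    suffices H : (S.filter fun v => (S.erase v).image c = Finset.univ.erase i₀) = {v, w} by
      rw [H, Finset.card_pair hwv.symm]
    ext u
    simp only [Finset.mem_filter, Finset.mem_insert, Finset.mem_singleton]
    constructor
    · rintro ⟨huS, hu⟩
      by_contra! hne
      have hcu : c u ≠ i₀ := (hmem _).2 ⟨u, ⟨hne.1, huS⟩, rfl⟩
      have : c u ∈ (S.erase u).image c := by rw [hu]; simpa using hcu
      obtain ⟨u', hu', hcu'⟩ := Finset.mem_image.1 this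
      obtain ⟨hu'u, hu'S⟩ := Finset.mem_erase.1 hu'
      by_cases hu'v : u' = v
      · refine hne.2 (hinj ?_ ?_ (hcu'.symm.trans ((congrArg c hu'v).trans hcw.symm)))
        · simp [hne.1, huS]
        · simp [hwv, hwS]
      · exact hu'u (hinj (by simp [hu'v, hu'S]) (by simp [hne.1, huS]) hcu')
    · rintro (hu | hu)
      · rw [hu]; exact ⟨hvS, him⟩
      · rw [hu]
        refine ⟨hwS, ?_⟩
        ext i
        simp only [Finset.mem_image, Finset.mem_erase, Finset.mem_univ, and_true]
        rw [hmem i]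
        constructor
        · rintro ⟨u, ⟨hu, huS⟩, rfl⟩
          by_cases huv : u = v
          · exact ⟨w, ⟨hwv, hwS⟩, by rw [huv, hcw]⟩
          · exact ⟨u, ⟨huv, huS⟩, rfl⟩
        · rintro ⟨u, ⟨hu, huS⟩, rfl⟩
          by_cases huw : u = w
          · exact ⟨v, ⟨hwv.symm, hvS⟩, by rw [huw, hcw]⟩
          · exact ⟨u, ⟨huw, huS⟩, rfl⟩

/-- Double counting of the pairs of a member of the family `R` and a facet of it that has the
property `p`. -/
theorem sum_card_facets_eq_sum_card_cofaces {V : Type*} [Fintype V] [DecidableEq V]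
    (R : Finset (Finset V)) (p : Finset V → Prop) [DecidablePred p] :
    ∑ S ∈ R, (S.filter fun v => p (S.erase v)).card =
      ∑ d ∈ Finset.univ.filter p, (Finset.univ.filter fun v => v ∉ d ∧ insert v d ∈ R).card := by
  rw [← Finset.card_sigma, ← Finset.card_sigma]
  refine Finset.card_bij' (fun a _ => ⟨a.1.erase a.2, a.2⟩) (fun a _ => ⟨insert a.2 a.1, a.2⟩)
    ?_ ?_ ?_ ?_
  · rintro ⟨S, v⟩ h
    simp only [Finset.mem_sigma, Finset.mem_filter, Finset.mem_univ, true_and] at h ⊢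
    refine ⟨h.2.2, Finset.notMem_erase _ _, ?_⟩
    rw [Finset.insert_erase h.2.1]; exact h.1
  · rintro ⟨d, v⟩ h
    simp only [Finset.mem_sigma, Finset.mem_filter, Finset.mem_univ, true_and] at h ⊢
    refine ⟨h.2.2, Finset.mem_insert_self _ _, ?_⟩
    rw [Finset.erase_insert h.2.1]; exact h.1
  · rintro ⟨S, v⟩ h
    simp only [Finset.mem_sigma, Finset.mem_filter] at h
    simp [Finset.insert_erase h.2.1]
  · rintro ⟨d, v⟩ h
    simp only [Finset.mem_sigma, Finset.mem_filter, Finset.mem_univ, true_and] at h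
    simp [Finset.erase_insert h.2.1]

/-- A face of codimension one that contains a point of `T` lies in exactly two dominant faces of
full dimension if it is dominant, and in none otherwise. -/
theorem even_card_dominant_cofaces {T I : Type*} [Fintype T] [DecidableEq T] [Fintype I]
    [DecidableEq I] (r : I → T → ℕ) (hr : ∀ i, Function.Injective (r i)) (d : Finset (T ⊕ I))
    (hd : d.card + 1 = Fintype.card I) (hT : ∃ y, Sum.inl y ∈ d)
    [DecidablePred (IsDominantFace r)] :
    (Finset.univ.filter fun v => v ∉ d ∧ IsDominantFace r (insert v d)).card % 2 = 0 := by
  by_cases hdom : IsDominantFace r d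
  swap
  · rw [Finset.filter_false_of_mem]
    · simp
    · rintro v - ⟨-, h⟩
      exact hdom (h.mono (Finset.subset_insert _ _))
  -- the lowest-ranked point of the face for each index
  have hmin : ∀ i, ∃ z, Sum.inl z ∈ d ∧ ∀ y, Sum.inl y ∈ d → r i z ≤ r i y := by
    intro i
    obtain ⟨y₀, hy₀⟩ := hT
    obtain ⟨z, hz, hz'⟩ := Finset.exists_min_image d.toLeft (r i)
      ⟨y₀, Finset.mem_toLeft.2 hy₀⟩
    exact ⟨z, Finset.mem_toLeft.1 hz, fun y hy => hz' y (Finset.mem_toLeft.2 hy)⟩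
  choose m hm hle using hmin
  have huniq : ∀ i z, Sum.inl z ∈ d → (∀ y, Sum.inl y ∈ d → r i z ≤ r i y) → m i = z :=
    fun i z hz h => hr i (le_antisymm (hle i z hz) (h _ (hm i)))
  have hsurj : ∀ z, Sum.inl z ∈ d → ∃ k, Sum.inr k ∉ d ∧ m k = z := by
    intro z hz
    obtain ⟨k, hk, h⟩ := hdom z
    exact ⟨k, hk, huniq k z hz h⟩
  have hcard : d.toLeft.card + 1 = d.toRightᶜ.card := by
    have h1 := Finset.card_toLeft_add_card_toRight (u := d)
    have h2 := Finset.card_add_card_compl d.toRight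
    omega
  -- exactly one pair of indices off the face share their lowest-ranked point
  obtain ⟨i, hi, j, hj, hij, hmij⟩ : ∃ i, Sum.inr i ∉ d ∧ ∃ j, Sum.inr j ∉ d ∧ i ≠ j ∧ m i = m j := by
    obtain ⟨i, hi, j, hj, h⟩ := Finset.exists_ne_map_eq_of_card_lt_of_maps_to
      (s := d.toRightᶜ) (t := d.toLeft) (f := m) (by omega)
      (fun k _ => Finset.mem_coe.2 (Finset.mem_toLeft.2 (hm k)))
    exact ⟨i, by simpa using hi, j, by simpa using hj, h⟩
  have hinj : ∀ i j, Sum.inr i ∉ d → Sum.inr j ∉ d → i ≠ j → m i = m j →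
      ∀ k k', Sum.inr k ∉ d → Sum.inr k' ∉ d → k ≠ i → k' ≠ i → m k = m k' → k = k' := by
    intro i j hi hj hij hmij k k' hk hk' hki hki' hkk'
    refine Finset.injOn_of_surjOn_of_card_le (s := d.toRightᶜ.erase i) (t := d.toLeft) m
      (fun k _ => Finset.mem_coe.2 (Finset.mem_toLeft.2 (hm k))) ?_ ?_ ?_ ?_ hkk'
    · intro z hz
      obtain ⟨l, hl, rfl⟩ := hsurj z (Finset.mem_toLeft.1 hz)
      by_cases hli : l = i
      · exact ⟨j, by simp [hij.symm, hj], by rw [hli, hmij]⟩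
      · exact ⟨l, by simp [hli, hl], rfl⟩
    · rw [Finset.card_erase_of_mem (by simpa using hi)]; omega
    · simp [hki, hk]
    · simp [hki', hk']
  have hpair : ∀ k k', Sum.inr k ∉ d → Sum.inr k' ∉ d → k ≠ k' → m k = m k' → k = i ∨ k = j := by
    intro k k' hk hk' hne h
    by_contra! hcon
    by_cases hk'i : k' = i
    · exact hne (hinj j i hj hi hij.symm hmij.symm k k' hk hk' hcon.2 (hk'i ▸ hij) h)
    · exact hne (hinj i j hi hj hij hmij k k' hk hk' hcon.1 hk'i h)
  -- `X k` holds for the points that all indices but `k` rank above the face. The vertex `v` extends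
  -- the face in the direction `k` if it is the `k`-highest such point, or the slack vertex of `k` if
  -- there is none. Each direction has one extension, and only the directions `i` and `j` occur.
  let X : I → T → Prop := fun k x => ∀ l, Sum.inr l ∉ d → l ≠ k → r l (m l) < r l x
  let Ext : I → T ⊕ I → Prop := fun k v =>
    (v = Sum.inr k ∧ ∀ x, ¬ X k x) ∨ (∃ y, v = Sum.inl y ∧ X k y ∧ ∀ x, X k x → r k x ≤ r k y)
  have hExt : ∀ k, ∃ v, Ext k v ∧ ∀ w, Ext k w → w = v := by
    intro k
    by_cases hX : ∃ x, X k x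
    · classical
      obtain ⟨x₀, hx₀⟩ := hX
      obtain ⟨y, hy, hmax⟩ := Finset.exists_max_image (Finset.univ.filter (X k)) (r k)
        ⟨x₀, by simpa using hx₀⟩
      simp only [Finset.mem_filter, Finset.mem_univ, true_and] at hy hmax
      refine ⟨Sum.inl y, Or.inr ⟨y, rfl, hy, hmax⟩, ?_⟩
      rintro w (⟨-, h⟩ | ⟨y', rfl, hy', hmax'⟩)
      · exact absurd hx₀ (h x₀)
      · rw [hr k (le_antisymm (hmax _ hy') (hmax' _ hy))]
    · push Not at hX
      refine ⟨Sum.inr k, Or.inl ⟨rfl, hX⟩, ?_⟩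
      rintro w (⟨h, -⟩ | ⟨y', -, hy', -⟩)
      · exact h
      · exact absurd hy' (hX _)
  have hback : ∀ k k', Sum.inr k ∉ d → Sum.inr k' ∉ d → k ≠ k' → m k = m k' → ∀ v, Ext k v →
      v ∉ d ∧ IsDominantFace r (insert v d) := by
    intro k k' hk hk' hne hmk v hv
    have hnX : ∀ x, ¬ X k x → ∃ l, Sum.inr l ∉ d ∧ l ≠ k ∧ r l x ≤ r l (m l) := by
      intro x hx
      simp only [X] at hx
      push Not at hx
      obtain ⟨l, h1, h2, h3⟩ := hx
      exact ⟨l, h1, h2, h3⟩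
    rcases hv with ⟨rfl, hX⟩ | ⟨y, rfl, hy, hmax⟩
    · refine ⟨hk, fun x => ?_⟩
      obtain ⟨l, hl, hlk, hlx⟩ := hnX x (hX x)
      refine ⟨l, by simp [hl, hlk], fun z hz => hlx.trans (hle l z (by simpa using hz))⟩
    · constructor
      · intro hyd
        obtain ⟨l, hl, rfl⟩ := hsurj y hyd
        by_cases hlk : l = k
        · have := hy k' hk' hne.symm
          rw [hlk, hmk] at this
          exact lt_irrefl _ this
        · exact lt_irrefl _ (hy l hl hlk)
      · intro x
        by_cases hx : X k x
        · refine ⟨k, by simpa using hk, ?_⟩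
          intro z hz
          rcases Finset.mem_insert.1 hz with h | hz
          · rw [Sum.inl.inj h]; exact hmax x hx
          · obtain ⟨l, hl, h⟩ := hdom y
            by_cases hlk : l = k
            · exact (hmax x hx).trans (hlk ▸ h z hz)
            · exact absurd (h _ (hm l)) (not_le.2 (hy l hl hlk))
        · obtain ⟨l, hl, hlk, hlx⟩ := hnX x hx
          refine ⟨l, by simpa using hl, ?_⟩
          intro z hz
          rcases Finset.mem_insert.1 hz with h | hz
          · rw [Sum.inl.inj h]; exact hlx.trans (hy l hl hlk).le
          · exact hlx.trans (hle l z hz)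
  have hforth : ∀ v, v ∉ d → IsDominantFace r (insert v d) → Ext i v ∨ Ext j v := by
    intro v hv hdv
    suffices H : ∃ k, (k = i ∨ k = j) ∧ Ext k v by
      obtain ⟨k, rfl | rfl, h⟩ := H
      · exact Or.inl h
      · exact Or.inr h
    rcases v with y | k
    · obtain ⟨k, hk, hyk⟩ := hdv y
      have hk' : Sum.inr k ∉ d := fun h => hk (Finset.mem_insert_of_mem h)
      have hz : ∀ z, Sum.inl z ∈ d → ∃ l, Sum.inr l ∉ d ∧ l ≠ k ∧ m l = z ∧ r l z < r l y := by
        intro z hz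
        obtain ⟨l, hl, hzl⟩ := hdv z
        have hlt : r l z < r l y :=
          lt_of_le_of_ne (hzl y (Finset.mem_insert_self _ _)) fun h => hv (hr l h ▸ hz)
        refine ⟨l, fun h => hl (Finset.mem_insert_of_mem h), ?_,
          huniq l z hz fun x hx => hzl x (Finset.mem_insert_of_mem hx), hlt⟩
        rintro rfl
        exact absurd (hyk z (Finset.mem_insert_of_mem hz)) (not_le.2 hlt)
      obtain ⟨l, hl, hlk, hml, -⟩ := hz (m k) (hm k)
      refine ⟨k, hpair k l hk' hl hlk.symm hml.symm, Or.inr ⟨y, rfl, ?_, ?_⟩⟩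
      · intro l' hl' hl'k
        obtain ⟨l'', hl'', hl''k, hml'', hlt⟩ := hz (m l') (hm l')
        rwa [hinj k l hk' hl hlk.symm hml.symm l'' l' hl'' hl' hl''k hl'k hml''] at hlt
      · intro x hx
        obtain ⟨l', hl', h⟩ := hdv x
        by_cases hl'k : l' = k
        · exact hl'k ▸ h y (Finset.mem_insert_self _ _)
        · exact absurd (h _ (Finset.mem_insert_of_mem (hm l')))
            (not_le.2 (hx l' (fun h => hl' (Finset.mem_insert_of_mem h)) hl'k))
    · obtain ⟨l, hl, hml⟩ := hdv (m k)
      simp only [Finset.mem_insert, Sum.inr.injEq, not_or] at hl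
      have hml' := huniq l (m k) (hm k) fun y hy => hml y (Finset.mem_insert_of_mem hy)
      refine ⟨k, hpair k l hv hl.2 (fun h => hl.1 h.symm) hml'.symm, Or.inl ⟨rfl, fun x hx => ?_⟩⟩
      obtain ⟨l', hl', h⟩ := hdv x
      simp only [Finset.mem_insert, Sum.inr.injEq, not_or] at hl'
      exact absurd (h _ (Finset.mem_insert_of_mem (hm l'))) (not_le.2 (hx l' hl'.2 hl'.1))
  obtain ⟨v, hv, hv'⟩ := hExt i
  obtain ⟨w, hw, hw'⟩ := hExt j
  have hvw : v ≠ w := by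
    rintro rfl
    rcases hv with ⟨rfl, -⟩ | ⟨y, rfl, hy, -⟩
    · rcases hw with ⟨h, -⟩ | ⟨y, h, -⟩
      · exact hij (Sum.inr.inj h)
      · exact Sum.inr_ne_inl h
    · rcases hw with ⟨h, -⟩ | ⟨y', h, hy', -⟩
      · exact Sum.inl_ne_inr h
      · obtain rfl := Sum.inl.inj h
        obtain ⟨l, hl, h⟩ := hdom y
        by_cases hli : l = i
        · exact absurd (h _ (hm l)) (not_le.2 (hy' l hl (hli ▸ hij)))
        · exact absurd (h _ (hm l)) (not_le.2 (hy l hl hli))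
  have : (Finset.univ.filter fun v => v ∉ d ∧ IsDominantFace r (insert v d)) = {v, w} := by
    ext u
    simp only [Finset.mem_filter, Finset.mem_univ, true_and, Finset.mem_insert,
      Finset.mem_singleton]
    constructor
    · rintro ⟨h1, h2⟩
      exact (hforth u h1 h2).imp (hv' u) (hw' u)
    · rintro (rfl | rfl)
      · exact hback i j hi hj hij hmij _ hv
      · exact hback j i hj hi hij.symm hmij.symm _ hw
  rw [this, Finset.card_pair hvw]

/-- **Scarf's lemma**: for every colouring `c` of the points of `T` by the indices there is a set `σ` of
points such that no point is ranked strictly above the lowest-ranked point of `σ` by all the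
indices that occur as colours in `σ`. -/
theorem exists_colorful_dominant {T I : Type*} [Fintype T] [Nonempty T] [Fintype I] [Nonempty I]
    (r : I → T → ℕ) (hr : ∀ i, Function.Injective (r i)) (c : T → I) :
    ∃ σ : Finset T, ∀ x, ∃ y ∈ σ, ∀ z ∈ σ, r (c y) x ≤ r (c y) z := by
  classical
  obtain ⟨i₀⟩ := ‹Nonempty I›
  -- a slack vertex has the colour of its index
  let c' : T ⊕ I → I := Sum.elim c id
  let R : Finset (Finset (T ⊕ I)) :=
    Finset.univ.filter fun S => S.card = Fintype.card I ∧ IsDominantFace r S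
  let p : Finset (T ⊕ I) → Prop := fun d => d.card + 1 = Fintype.card I ∧
    d.image c' = Finset.univ.erase i₀
  -- the facet that consists of slack vertices, the only one with an odd number of cofaces
  let d₀ : Finset (T ⊕ I) := (Finset.univ.erase i₀).map ⟨Sum.inr, Sum.inr_injective⟩
  have hpos : 0 < Fintype.card I := Fintype.card_pos_iff.2 ⟨i₀⟩
  have hd₀ : ∀ v, Sum.inr v ∈ d₀ ↔ v ≠ i₀ := by intro v; simp [d₀]
  have hd₀' : ∀ y, Sum.inl y ∉ d₀ := by intro v; simp [d₀]
  have hd₀card : d₀.card + 1 = Fintype.card I := by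
    rw [Finset.card_map, Finset.card_erase_of_mem (Finset.mem_univ _), Finset.card_univ]; omega
  have hpd₀ : p d₀ := by
    refine ⟨hd₀card, ?_⟩
    ext i
    simp [d₀, c']
  have hR : ∀ d : Finset (T ⊕ I), d.card + 1 = Fintype.card I →
      (Finset.univ.filter fun v => v ∉ d ∧ insert v d ∈ R) =
        Finset.univ.filter fun v => v ∉ d ∧ IsDominantFace r (insert v d) := by
    intro d hd
    ext v
    simp only [R, Finset.mem_filter, Finset.mem_univ, true_and]
    constructor
    · exact fun h => ⟨h.1, h.2.2⟩
    · exact fun h => ⟨h.1, by rw [Finset.card_insert_of_notMem h.1, hd], h.2⟩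
  have hone : (Finset.univ.filter fun v => v ∉ d₀ ∧ insert v d₀ ∈ R).card = 1 := by
    rw [hR d₀ hd₀card, Finset.card_eq_one]
    obtain ⟨t, -, ht⟩ := Finset.exists_max_image Finset.univ (r i₀) (Finset.univ_nonempty (α := T))
    refine ⟨Sum.inl t, ?_⟩
    ext v
    simp only [Finset.mem_filter, Finset.mem_univ, true_and, Finset.mem_singleton]
    rcases v with y | k
    · have hdom : IsDominantFace r (insert (Sum.inl y) d₀) ↔ ∀ x, r i₀ x ≤ r i₀ y := by
        refine forall_congr' fun x => ?_
        simp [hd₀, hd₀']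
      simp only [hd₀', not_false_eq_true, true_and, hdom, Sum.inl.injEq]
      exact ⟨fun h => hr i₀ (le_antisymm (ht y (Finset.mem_univ _)) (h t)),
        fun h x => h ▸ ht x (Finset.mem_univ _)⟩
    · simp only [hd₀, not_not, reduceCtorEq, iff_false, not_and]
      rintro rfl h
      obtain ⟨i, hi, -⟩ := h t
      simp only [Finset.mem_insert, Sum.inr.injEq, hd₀, not_or, not_not] at hi
      exact hi.1 hi.2
  have hsum := sum_card_facets_eq_sum_card_cofaces R p
  have hleft : (∑ S ∈ R, (S.filter fun v => p (S.erase v)).card) % 2 =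
      (R.filter fun S => S.image c' = Finset.univ).card % 2 := by
    rw [Finset.card_filter, Finset.sum_nat_mod, Finset.sum_nat_mod R 2 (fun S => ite _ _ _)]
    congr 1
    refine Finset.sum_congr rfl fun S hS => ?_
    have hScard : S.card = Fintype.card I := (Finset.mem_filter.1 hS).2.1
    have := card_facets_missing_color_mod_two c' i₀ S hScard
    have hp : (S.filter fun v => p (S.erase v)) =
        S.filter fun v => (S.erase v).image c' = Finset.univ.erase i₀ := by
      refine Finset.filter_congr fun v hv => ?_
      simp only [p, Finset.card_erase_of_mem hv, and_iff_right_iff_imp]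
      omega
    rw [hp, this]
    split_ifs <;> rfl
  have hright : (∑ d ∈ Finset.univ.filter p,
      (Finset.univ.filter fun v => v ∉ d ∧ insert v d ∈ R).card) % 2 = 1 := by
    rw [← Finset.add_sum_erase _ _ (Finset.mem_filter.2 ⟨Finset.mem_univ d₀, hpd₀⟩), hone,
      Nat.add_mod, Finset.sum_nat_mod, Finset.sum_eq_zero]
    · rfl
    intro d hd
    obtain ⟨hne, hd⟩ := Finset.mem_erase.1 hd
    obtain ⟨hdcard, him⟩ := (Finset.mem_filter.1 hd).2
    rw [hR d hdcard]
    refine even_card_dominant_cofaces r hr d hdcard ?_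
    by_contra! hno
    refine hne ((Finset.eq_of_subset_of_card_le ?_ (by omega)))
    rintro (y | k) hk
    · exact absurd hk (hno y)
    · have : k ∈ d.image c' := Finset.mem_image.2 ⟨_, hk, rfl⟩
      rw [him] at this
      exact (hd₀ k).2 (Finset.mem_erase.1 this).1
  have hne : (R.filter fun S => S.image c' = Finset.univ).Nonempty := by
    rw [← Finset.card_pos]
    omega
  obtain ⟨S, hS⟩ := hne
  obtain ⟨hSR, him⟩ := Finset.mem_filter.1 hS
  obtain ⟨-, hcard, hdom⟩ := Finset.mem_filter.1 hSR
  refine ⟨S.toLeft, fun x => ?_⟩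
  obtain ⟨i, hi, h⟩ := hdom x
  have : i ∈ S.image c' := by simp [him]
  obtain ⟨v, hv, hvi⟩ := Finset.mem_image.1 this
  rcases v with y | k
  · refine ⟨y, Finset.mem_toLeft.2 hv, fun z hz => ?_⟩
    have : c y = i := hvi
    rw [this]
    exact h z (Finset.mem_toLeft.1 hz)
  · exact absurd hv (by simpa using (show k = i from hvi) ▸ hi)

/-! ### Brouwer's fixed point theorem for the standard simplex -/

/-- The grid points of denominator `K` of the standard simplex, scaled up to natural numbers. -/
abbrev SimplexGrid (I : Type*) [Fintype I] (K : ℕ) : Type _ :=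
  {x : I → Fin (K + 1) // ∑ i, (x i : ℕ) = K}

/-- The combinatorial form of Brouwer's theorem: for every colouring of the grid of denominator `K`
there is a set `σ` of grid points whose coordinates differ by at most the number `n` of coordinates
and such that, for each colour `i` that does not occur in `σ`, the `i`-th coordinates
are at most `n`. -/
theorem exists_small_colorful_set {I : Type*} [Fintype I] [Nonempty I] (K : ℕ)
    (c : SimplexGrid I K → I) :
    ∃ σ : Finset (SimplexGrid I K), σ.Nonempty ∧
      (∀ y ∈ σ, ∀ z ∈ σ, ∀ i, (z.1 i : ℕ) ≤ y.1 i + Fintype.card I) ∧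
      ∀ i, (∃ y ∈ σ, c y = i) ∨ ∀ z ∈ σ, (z.1 i : ℕ) ≤ Fintype.card I := by
  classical
  have hmk : ∀ x : I → ℕ, ∑ i, x i = K → ∃ t : SimplexGrid I K, ∀ i, (t.1 i : ℕ) = x i := by
    intro x hx
    have hle : ∀ i, x i < K + 1 := fun i =>
      Nat.lt_succ_of_le (hx ▸ Finset.single_le_sum (fun _ _ => Nat.zero_le _) (Finset.mem_univ i))
    exact ⟨⟨fun i => ⟨x i, hle i⟩, hx⟩, fun i => rfl⟩
  have hne : Nonempty (SimplexGrid I K) := by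
    obtain ⟨i⟩ := ‹Nonempty I›
    obtain ⟨t, -⟩ := hmk (Pi.single i K) (by simp)
    exact ⟨t⟩
  -- rank by the `i`-th coordinate, and break ties by a fixed enumeration of the grid
  let e := Fintype.equivFin (SimplexGrid I K)
  let n := Fintype.card (SimplexGrid I K)
  let r : I → SimplexGrid I K → ℕ := fun i x => x.1 i * n + e x
  have hr : ∀ i, Function.Injective (r i) := by
    intro i x y h
    have h' : (e x : ℕ) = e y := by
      have := congrArg (· % n) h
      simp only [r, Nat.mul_add_mod_self_right] at this
      rwa [Nat.mod_eq_of_lt (e x).2, Nat.mod_eq_of_lt (e y).2] at this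
    exact e.injective (Fin.ext h')
  have hlt : ∀ i x y, (x.1 i : ℕ) < y.1 i → r i x < r i y := by
    intro i x y h
    have h1 : ((x.1 i : ℕ) + 1) * n ≤ y.1 i * n := Nat.mul_le_mul_right _ h
    have h2 : (e x : ℕ) < n := (e x).2
    simp only [r]
    linarith
  obtain ⟨σ, hσ⟩ := exists_colorful_dominant r hr c
  have hσne : σ.Nonempty := by
    obtain ⟨x⟩ := hne
    obtain ⟨y, hy, -⟩ := hσ x
    exact ⟨y, hy⟩
  choose a ha hale using fun i => Finset.exists_min_image σ (fun y => (y.1 i : ℕ)) hσne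
  let C := σ.image c
  -- otherwise some grid point exceeds all the minima of the coordinates in `C`
  have hsum : K < ∑ i ∈ C, ((a i).1 i + 1 : ℕ) := by
    by_contra! hle
    obtain ⟨y₁, hy₁⟩ := hσne
    obtain ⟨t, ht⟩ := hmk (fun i => (if i ∈ C then ((a i).1 i + 1 : ℕ) else 0) +
      if i = c y₁ then K - ∑ i ∈ C, ((a i).1 i + 1 : ℕ) else 0) (by
        rw [Finset.sum_add_distrib, Finset.sum_ite_mem, Finset.sum_ite_eq']
        simp only [Finset.univ_inter, Finset.mem_univ, if_true]
        omega)
    obtain ⟨y, hy, h⟩ := hσ t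
    refine absurd (h _ (ha (c y))) (not_le.2 (hlt _ _ _ ?_))
    rw [ht, if_pos (Finset.mem_image_of_mem c hy)]
    omega
  have hkey : ∀ z ∈ σ, ∑ i, ((z.1 i : ℕ) - if i ∈ C then ((a i).1 i : ℕ) else 0) ≤
      Fintype.card I := by
    intro z hz
    have h1 : ∑ i, ((z.1 i : ℕ) - if i ∈ C then ((a i).1 i : ℕ) else 0) +
        ∑ i, (if i ∈ C then ((a i).1 i : ℕ) else 0) = K := by
      rw [← Finset.sum_add_distrib]
      refine Eq.trans (Finset.sum_congr rfl fun i _ => Nat.sub_add_cancel ?_) z.2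
      split_ifs
      · exact hale i z hz
      · exact Nat.zero_le _
    rw [Finset.sum_ite_mem, Finset.univ_inter] at h1
    rw [Finset.sum_add_distrib, Finset.sum_const, smul_eq_mul, mul_one] at hsum
    have := Finset.card_le_univ C
    omega
  have hkey' : ∀ z ∈ σ, ∀ i, (z.1 i : ℕ) ≤ (if i ∈ C then ((a i).1 i : ℕ) else 0) +
      Fintype.card I := by
    intro z hz i
    have := Finset.single_le_sum (f := fun i => (z.1 i : ℕ) - if i ∈ C then ((a i).1 i : ℕ) else 0)
      (fun _ _ => Nat.zero_le _) (Finset.mem_univ i)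
    have := hkey z hz
    omega
  refine ⟨σ, hσne, fun y hy z hz i => ?_, fun i => ?_⟩
  · have h1 := hkey' z hz i
    have h2 := hale i y hy
    split_ifs at h1 <;> omega
  · by_cases hi : i ∈ C
    · exact Or.inl (Finset.mem_image.1 hi)
    · right
      intro z hz
      have := hkey' z hz i
      rwa [if_neg hi, zero_add] at this

/-- A grid point is coloured by a coordinate that `f` does not decrease. On a set of small
diameter no coordinate whose colour occurs is decreased by much, nor is one that is itself small. -/
theorem exists_approx_fixedPoint_stdSimplex {I : Type*} [Fintype I] [Nonempty I]
    (f : stdSimplex ℝ I → stdSimplex ℝ I) (hf : Continuous f) {ε : ℝ} (hε : 0 < ε) :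
    ∃ z, ∀ i, z.1 i ≤ (f z).1 i + ε := by
  have hunif := CompactSpace.uniformContinuous_of_continuous hf
  obtain ⟨δ, hδ, hfδ⟩ := Metric.uniformContinuous_iff.1 hunif (ε / 2) (by positivity)
  set n : ℝ := (Fintype.card I : ℝ) with hn
  obtain ⟨K, hK⟩ := exists_nat_gt (n / min δ (ε / 2))
  have hmin : 0 < min δ (ε / 2) := lt_min hδ (by positivity)
  have hK0 : (0 : ℝ) < K := lt_of_le_of_lt (by positivity) hK
  have hnK : n / K < min δ (ε / 2) := by
    rw [div_lt_iff₀ hmin] at hK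
    rw [div_lt_iff₀ hK0]
    linarith
  let p : SimplexGrid I K → stdSimplex ℝ I := fun x => ⟨fun i => ((x.1 i : ℕ) : ℝ) / K,
    fun i => by positivity, by
      rw [← Finset.sum_div, ← Nat.cast_sum, x.2, div_self hK0.ne']⟩
  have hcol : ∀ x : SimplexGrid I K, ∃ i, (p x).1 i ≤ (f (p x)).1 i := by
    intro x
    by_contra! h
    have h' := Finset.sum_lt_sum_of_nonempty (Finset.univ_nonempty (α := I)) fun i _ => h i
    rw [(p x).2.2, (f (p x)).2.2] at h'
    exact lt_irrefl _ h'
  choose c hc using hcol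
  obtain ⟨σ, ⟨z, hz⟩, hdiam, hσ⟩ := exists_small_colorful_set K c
  have hdiam' : ∀ y ∈ σ, ∀ z ∈ σ, ∀ i, (p z).1 i ≤ (p y).1 i + n / K := by
    intro y hy z hz i
    simp only [p, ← add_div]
    gcongr
    rw [hn]
    exact_mod_cast hdiam y hy z hz i
  refine ⟨p z, fun i => ?_⟩
  rcases hσ i with ⟨y, hy, rfl⟩ | h
  · have hd : dist (p y) (p z) < δ := by
      refine lt_of_le_of_lt ?_ (hnK.trans_le (min_le_left _ _))
      rw [Subtype.dist_eq]
      refine (dist_pi_le_iff (by positivity)).2 fun i => ?_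
      rw [Real.dist_eq, abs_le]
      constructor <;> linarith [hdiam' y hy z hz i, hdiam' z hz y hy i]
    have h1 := (dist_le_pi_dist (f (p y)).1 (f (p z)).1 (c y)).trans_lt (hfδ hd)
    rw [Real.dist_eq, abs_lt] at h1
    linarith [hdiam' y hy z hz (c y), hc y, min_le_right δ (ε / 2)]
  · have h1 : (p z).1 i ≤ n / K := by
      simp only [p]
      gcongr
      rw [hn]
      exact_mod_cast h z hz
    linarith [(f (p z)).2.1 i, min_le_right δ (ε / 2)]

/-- **Brouwer's fixed point theorem** for the standard simplex. -/
theorem exists_fixedPoint_stdSimplex {I : Type*} [Fintype I] [Nonempty I]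
    (f : stdSimplex ℝ I → stdSimplex ℝ I) (hf : Continuous f) : ∃ z, f z = z := by
  classical
  obtain ⟨i₀⟩ := ‹Nonempty I›
  have hne : Nonempty (stdSimplex ℝ I) := ⟨⟨_, single_mem_stdSimplex ℝ i₀⟩⟩
  obtain ⟨z₀, -, hz₀⟩ := isCompact_univ.exists_isMinOn Set.univ_nonempty
    ((hf.dist continuous_id).continuousOn (s := Set.univ))
  refine ⟨z₀, ?_⟩
  by_contra hne
  have hpos : 0 < dist (f z₀) z₀ := dist_pos.2 hne
  set n : ℝ := (Fintype.card I : ℝ) with hn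
  have hn0 : 0 < n := by rw [hn]; exact_mod_cast Fintype.card_pos
  obtain ⟨z, hz⟩ := exists_approx_fixedPoint_stdSimplex f hf
    (ε := dist (f z₀) z₀ / (2 * n)) (by positivity)
  have hle : dist (f z₀) z₀ ≤ dist (f z) z := hz₀ (Set.mem_univ z)
  have hle' : dist (f z) z ≤ dist (f z₀) z₀ / 2 := by
    rw [Subtype.dist_eq]
    refine (dist_pi_le_iff (by positivity)).2 fun i => ?_
    -- the coordinate differences sum to zero, so that upper bounds give lower bounds
    have h1 : ∑ k, ((f z).1 k + dist (f z₀) z₀ / (2 * n) - z.1 k) = dist (f z₀) z₀ / 2 := by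
      rw [Finset.sum_sub_distrib, Finset.sum_add_distrib, (f z).2.2, z.2.2, Finset.sum_const,
        Finset.card_univ, nsmul_eq_mul, ← hn]
      field_simp
      ring
    have h2 := Finset.single_le_sum (f := fun k => (f z).1 k + dist (f z₀) z₀ / (2 * n) - z.1 k)
      (fun k _ => by linarith [hz k]) (Finset.mem_univ i)
    have h3 : dist (f z₀) z₀ / (2 * n) ≤ dist (f z₀) z₀ / 2 := by
      gcongr
      have : (1 : ℝ) ≤ n := by rw [hn]; exact_mod_cast Fintype.card_pos (α := I)
      linarith
    have h4 : 0 < dist (f z₀) z₀ / (2 * n) := by positivity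
    rw [Real.dist_eq, abs_le]
    constructor <;> linarith [hz i]
  linarith

/-! ### Determinants of positive definite matrices and water-filling -/

namespace Matrix

variable {n m : Type*} [Fintype n] [DecidableEq n] [Fintype m] [DecidableEq m]

open scoped MatrixOrder Matrix.Norms.L2Operator in
theorem PosSemidef.exists_eq_conjTranspose_mul_self {A : Matrix n n ℂ} (hA : A.PosSemidef) :
    ∃ B : Matrix n n ℂ, A = Bᴴ * B :=
  CStarAlgebra.nonneg_iff_eq_star_mul_self.mp hA.nonneg

theorem IsHermitian.det_one_add {A : Matrix n n ℂ} (hA : A.IsHermitian) :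
    (1 + A).det = ((∏ i, (1 + hA.eigenvalues i) : ℝ) : ℂ) := by
  have h : 1 + A = Unitary.conjStarAlgAut ℂ (Matrix n n ℂ) hA.eigenvectorUnitary
      (diagonal fun i => ((1 + hA.eigenvalues i : ℝ) : ℂ)) := by
    conv_lhs => rw [hA.spectral_theorem, ← map_one (Unitary.conjStarAlgAut ℂ (Matrix n n ℂ)
      hA.eigenvectorUnitary), ← map_add, ← diagonal_one, diagonal_add]
    simp
  rw [h, Unitary.conjStarAlgAut_apply, det_mul_right_comm]
  simp

theorem PosSemidef.one_le_re_det_one_add {A : Matrix n n ℂ} (hA : A.PosSemidef) :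
    1 ≤ (1 + A).det.re := by
  rw [hA.1.det_one_add, Complex.ofReal_re]
  exact (Finset.prod_const_one (ι := n)).symm.le.trans <| Finset.prod_le_prod
    (fun _ _ => zero_le_one) fun i _ => by linarith [hA.eigenvalues_nonneg i]

theorem PosSemidef.one_lt_re_det_one_add {A : Matrix n n ℂ} (hA : A.PosSemidef) (h : A ≠ 0) :
    1 < (1 + A).det.re := by
  have hne : ∃ i, hA.1.eigenvalues i ≠ 0 := by
    by_contra! hall
    exact h (hA.1.eigenvalues_eq_zero_iff.1 (funext hall))
  obtain ⟨i, hi⟩ := hne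
  rw [hA.1.det_one_add, Complex.ofReal_re]
  calc (1 : ℝ) = ∏ i : n, (1 : ℝ) := by simp
    _ < _ := Finset.prod_lt_prod (fun _ _ => one_pos)
      (fun i _ => by linarith [hA.eigenvalues_nonneg i])
      ⟨i, Finset.mem_univ i, by linarith [lt_of_le_of_ne (hA.eigenvalues_nonneg i) hi.symm]⟩

/-- A positive definite matrix is a congruence transform of the identity, and any positive
semidefinite matrix can be written as a transform by the same invertible matrix. -/
theorem PosDef.exists_congr {X Y : Matrix n n ℂ} (hX : X.PosDef) (hY : Y.PosSemidef) :
    ∃ B Z : Matrix n n ℂ, X = Bᴴ * B ∧ Y = Bᴴ * Z * B ∧ Z.PosSemidef := by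
  obtain ⟨B, hB⟩ := hX.posSemidef.exists_eq_conjTranspose_mul_self
  have hdet : IsUnit B.det := by
    rw [isUnit_iff_ne_zero]
    intro h
    have := hX.det_pos
    rw [hB, det_mul, h, mul_zero] at this
    exact lt_irrefl _ this
  have hdet' : IsUnit Bᴴ.det := by rw [det_conjTranspose]; exact hdet.star
  refine ⟨B, (B⁻¹)ᴴ * Y * B⁻¹, hB, ?_, hY.conjTranspose_mul_mul_same _⟩
  rw [conjTranspose_nonsing_inv, mul_assoc _ Y, mul_assoc Bᴴ, mul_assoc (Bᴴ⁻¹), mul_assoc Y,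
    nonsing_inv_mul _ hdet, mul_one, mul_nonsing_inv_cancel_left _ _ hdet']

theorem re_det_congr (B Z : Matrix n n ℂ) :
    (Bᴴ * Z * B).det.re = Complex.normSq B.det * Z.det.re := by
  have h : (Bᴴ * Z * B).det = (Complex.normSq B.det : ℂ) * Z.det := by
    rw [det_mul, det_mul, det_conjTranspose, Complex.normSq_eq_conj_mul_self]
    simp only [Complex.star_def]
    ring
  rw [h, Complex.re_ofReal_mul]

theorem PosDef.re_det_pos {X : Matrix n n ℂ} (hX : X.PosDef) : 0 < X.det.re :=
  (Complex.pos_iff.1 hX.det_pos).1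

theorem PosDef.re_det_lt_re_det_add {X Y : Matrix n n ℂ} (hX : X.PosDef) (hY : Y.PosSemidef)
    (h : Y ≠ 0) : X.det.re < (X + Y).det.re := by
  obtain ⟨B, Z, rfl, rfl, hZ⟩ := hX.exists_congr hY
  have h1 : Bᴴ * B + Bᴴ * Z * B = Bᴴ * (1 + Z) * B := by
    rw [mul_add, add_mul, mul_one]
  have h2 : (Bᴴ * B).det.re = Complex.normSq B.det := by
    have := re_det_congr B 1
    rwa [mul_one, det_one, Complex.one_re, mul_one] at this
  have hpos := hX.re_det_pos
  rw [h2] at hpos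
  rw [h1, re_det_congr, h2]
  refine lt_mul_of_one_lt_right hpos (hZ.one_lt_re_det_one_add ?_)
  rintro rfl
  exact h (by simp)

/-- The equality case of the concavity of the logarithm of the determinant: two positive
definite matrices with the same determinant are equal if the determinant of their midpoint is
not larger. -/
theorem PosDef.eq_of_re_det_midpoint_le {X Y : Matrix n n ℂ} (hX : X.PosDef) (hY : Y.PosDef)
    (hXY : X.det.re = Y.det.re)
    (hle : (X + Y).det.re ≤ 2 ^ Fintype.card n * X.det.re) : X = Y := by
  obtain ⟨B, Z, hXB, hYZ, hZ⟩ := hX.exists_congr hY.posSemidef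
  have h1 : X + Y = Bᴴ * (1 + Z) * B := by
    rw [hXB, hYZ, mul_add, add_mul, mul_one]
  have h2 : X.det.re = Complex.normSq B.det := by
    have := re_det_congr B 1
    rwa [mul_one, det_one, Complex.one_re, mul_one, ← hXB] at this
  have hpos := hX.re_det_pos
  rw [h1, re_det_congr, h2, mul_comm (2 ^ _)] at hle
  rw [hYZ, re_det_congr, h2] at hXY
  rw [h2] at hpos
  have hZdet : Z.det.re = 1 := (mul_right_cancel₀ hpos.ne' (by linarith))
  have hle' : (1 + Z).det.re ≤ 2 ^ Fintype.card n := le_of_mul_le_mul_left hle hpos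
  rw [hZ.1.det_one_add, Complex.ofReal_re] at hle'
  have hprod : ∏ i, hZ.1.eigenvalues i = 1 := by
    have := hZ.1.det_eq_prod_eigenvalues
    rw [← hZdet, this]
    simp [← Complex.ofReal_prod]
  have heig : ∀ i, 0 < hZ.1.eigenvalues i := fun i =>
    lt_of_le_of_ne (hZ.eigenvalues_nonneg i) fun h => by
      rw [Finset.prod_eq_zero (Finset.mem_univ i) h.symm] at hprod
      exact zero_ne_one hprod
  -- `4 z ≤ (1 + z) ^ 2`, with equality only for `z = 1`
  have hone : ∀ i, hZ.1.eigenvalues i = 1 := by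
    by_contra! hne
    obtain ⟨i, hi⟩ := hne
    have hlt : ∏ i, 4 * hZ.1.eigenvalues i < ∏ i, (1 + hZ.1.eigenvalues i) ^ 2 :=
      Finset.prod_lt_prod (fun i _ => by linarith [heig i])
        (fun i _ => by nlinarith [sq_nonneg (1 - hZ.1.eigenvalues i)])
        ⟨i, Finset.mem_univ i, by nlinarith [sq_pos_of_ne_zero (sub_ne_zero.2 hi)]⟩
    rw [Finset.prod_mul_distrib, hprod, Finset.prod_const, Finset.card_univ, mul_one,
      Finset.prod_pow] at hlt
    have h0 : 0 ≤ ∏ i, (1 + hZ.1.eigenvalues i) :=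
      Finset.prod_nonneg fun i _ => by linarith [heig i]
    have := pow_le_pow_left₀ h0 hle' 2
    rw [← pow_mul, mul_comm, pow_mul] at this
    norm_num at this
    linarith
  have hZ1 : Z = 1 := by
    rw [hZ.1.spectral_theorem]
    have : (RCLike.ofReal ∘ hZ.1.eigenvalues : n → ℂ) = fun _ => 1 := by
      ext i; simp [hone i]
    rw [this, diagonal_one, map_one]
  rw [hYZ, hZ1, mul_one, hXB]

/-- The matrix on the right is Hermitian for Hermitian `Q`, unlike the one on the left. -/
theorem det_one_add_conjTranspose_mul_self_mul (A : Matrix m n ℂ) (Q : Matrix n n ℂ) :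
    (1 + Aᴴ * A * Q).det = (1 + A * Q * Aᴴ).det := by
  rw [Matrix.mul_assoc, det_one_add_mul_comm]

theorem PosSemidef.one_le_re_det_one_add_mul {G Q : Matrix n n ℂ} (hG : G.PosSemidef)
    (hQ : Q.PosSemidef) : 1 ≤ (1 + G * Q).det.re := by
  obtain ⟨A, rfl⟩ := hG.exists_eq_conjTranspose_mul_self
  rw [det_one_add_conjTranspose_mul_self_mul]
  exact (hQ.mul_mul_conjTranspose_same A).one_le_re_det_one_add

/-- Compressing `Q` to the orthogonal complement of a vector `v` of the kernel of `G` does not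
change `det (1 + G Q)`, and it lowers the trace unless `v` is in the kernel of `Q`. -/
theorem PosSemidef.exists_trace_lt {G Q : Matrix n n ℂ} (hG : G.PosSemidef) (hQ : Q.PosSemidef)
    {v : n → ℂ} (hGv : G *ᵥ v = 0) (hQv : Q *ᵥ v ≠ 0) :
    ∃ Q' : Matrix n n ℂ, Q'.PosSemidef ∧ Q'.trace.re < Q.trace.re ∧
      (1 + G * Q').det = (1 + G * Q).det := by
  set s : ℂ := star v ⬝ᵥ v with hs
  have hv : v ≠ 0 := by rintro rfl; simp at hQv
  have hs0 : 0 < s := dotProduct_star_self_pos_iff.2 hv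
  -- `W` is the orthogonal projection to the complement of `v`
  set V : Matrix n n ℂ := vecMulVec v (star v) with hV
  have hVH : Vᴴ = V := by rw [hV, conjTranspose_vecMulVec, star_star]
  have hVV : V * V = s • V := by
    rw [hV, vecMulVec_mul_vecMulVec, vecMulVec_smul]
  have hsstar : star s = s := by
    rw [hs, ← star_dotProduct_star, star_star]
  set W : Matrix n n ℂ := 1 - s⁻¹ • V with hW
  have hWH : Wᴴ = W := by
    rw [hW, conjTranspose_sub, conjTranspose_smul, hVH, conjTranspose_one, star_inv₀, hsstar]
  have hWW : W * W = W := by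
    rw [hW, sub_mul, one_mul, mul_sub, mul_one, smul_mul_smul_comm, hVV, smul_smul, mul_assoc,
      inv_mul_cancel₀ hs0.ne', mul_one, sub_self, sub_zero]
  have hGW : G * W = G := by
    rw [hW, mul_sub, mul_one, mul_smul_comm, hV, mul_vecMulVec, hGv]
    simp
  have hWG : W * G = G := by
    have := congrArg Matrix.conjTranspose hGW
    rwa [conjTranspose_mul, hWH, hG.1.eq] at this
  refine ⟨W * Q * W, ?_, ?_, ?_⟩
  · have := hQ.conjTranspose_mul_mul_same W
    rwa [hWH] at this
  · have h0 : 0 < star v ⬝ᵥ Q *ᵥ v :=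
      lt_of_le_of_ne (hQ.dotProduct_mulVec_nonneg v)
        fun h => hQv ((hQ.dotProduct_mulVec_zero_iff v).1 h.symm)
    have htr : (W * Q * W).trace = Q.trace - s⁻¹ * (star v ⬝ᵥ Q *ᵥ v) := by
      rw [mul_assoc, trace_mul_comm, mul_assoc, hWW, hW, mul_sub, mul_one, mul_smul_comm, hV,
        mul_vecMulVec, trace_sub, trace_smul, trace_vecMulVec, smul_eq_mul, dotProduct_comm]
    have h1 : 0 < s⁻¹ * (star v ⬝ᵥ Q *ᵥ v) := mul_pos (inv_pos.2 hs0) h0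
    rw [htr, Complex.sub_re]
    linarith [(Complex.pos_iff.1 h1).1]
  · rw [mul_assoc, ← mul_assoc G, hGW, ← mul_assoc, det_one_add_mul_comm, ← mul_assoc, hWG]

/-- If the trace constraint is not active then `det (1 + G Q)` is not maximal. -/
theorem PosSemidef.exists_re_det_lt {G Q : Matrix n n ℂ} (hG : G.PosSemidef) (hG0 : G ≠ 0)
    (hQ : Q.PosSemidef) {p : ℝ} (hp : Q.trace.re < p) :
    ∃ Q' : Matrix n n ℂ, Q'.PosSemidef ∧ Q'.trace.re ≤ p ∧
      (1 + G * Q).det.re < (1 + G * Q').det.re := by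
  obtain ⟨A, rfl⟩ := hG.exists_eq_conjTranspose_mul_self
  set ε : ℝ := (p - Q.trace.re) / (Fintype.card n + 1) with hε
  have hε0 : 0 < ε := div_pos (by linarith) (by positivity)
  have hE : ((ε : ℂ) • (1 : Matrix n n ℂ)).PosSemidef :=
    PosSemidef.one.smul (by exact_mod_cast hε0.le)
  refine ⟨Q + (ε : ℂ) • 1, hQ.add hE, ?_, ?_⟩
  · have : ε * (Fintype.card n + 1) = p - Q.trace.re := by
      rw [hε]; field_simp
    rw [trace_add, trace_smul, trace_one, Complex.add_re, smul_eq_mul, Complex.re_ofReal_mul,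
      Complex.natCast_re]
    linarith
  · rw [det_one_add_conjTranspose_mul_self_mul, det_one_add_conjTranspose_mul_self_mul, mul_add,
      add_mul, ← add_assoc]
    refine PosDef.re_det_lt_re_det_add
      (PosDef.one.add_posSemidef (hQ.mul_mul_conjTranspose_same A))
      (hE.mul_mul_conjTranspose_same A) ?_
    rw [mul_smul_comm, smul_mul_assoc, mul_one]
    intro h
    rcases smul_eq_zero.1 h with h | h
    · exact hε0.ne' (by exact_mod_cast h)
    · rw [self_mul_conjTranspose_eq_zero] at h
      exact hG0 (by rw [h, mul_zero])

/-- Water-filling has a unique solution: `det (1 + G Q)` has at most one maximizer among the positive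
semidefinite matrices `Q` of bounded trace if `G` is not zero. -/
theorem PosSemidef.maximizer_unique {G Q₁ Q₂ : Matrix n n ℂ} {p : ℝ} (hG : G.PosSemidef)
    (hG0 : G ≠ 0) (hQ₁ : Q₁.PosSemidef) (hQ₂ : Q₂.PosSemidef) (ht₁ : Q₁.trace.re ≤ p)
    (ht₂ : Q₂.trace.re ≤ p)
    (h₁ : ∀ Q : Matrix n n ℂ, Q.PosSemidef → Q.trace.re ≤ p →
      (1 + G * Q).det.re ≤ (1 + G * Q₁).det.re)
    (h₂ : ∀ Q : Matrix n n ℂ, Q.PosSemidef → Q.trace.re ≤ p →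
      (1 + G * Q).det.re ≤ (1 + G * Q₂).det.re) : Q₁ = Q₂ := by
  -- a maximizer vanishes on the kernel of `G`
  have hker : ∀ Q : Matrix n n ℂ, Q.PosSemidef → Q.trace.re ≤ p →
      (∀ Q' : Matrix n n ℂ, Q'.PosSemidef → Q'.trace.re ≤ p →
        (1 + G * Q').det.re ≤ (1 + G * Q).det.re) → ∀ v, G *ᵥ v = 0 → Q *ᵥ v = 0 := by
    intro Q hQ ht h v hGv
    by_contra hQv
    obtain ⟨Q', hQ', ht', hdet⟩ := hG.exists_trace_lt hQ hGv hQv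
    obtain ⟨Q'', hQ'', ht'', hlt⟩ := hG.exists_re_det_lt hG0 hQ' (ht'.trans_le ht)
    rw [hdet] at hlt
    exact absurd (h Q'' hQ'' ht'') (not_le.2 hlt)
  -- it follows that `G E = 0` and `E = 0` for the Hermitian difference `E`, once `G E G = 0` is known
  set E := Q₁ - Q₂ with hE
  have hEker : ∀ v, G *ᵥ v = 0 → E *ᵥ v = 0 := by
    intro v hv
    rw [hE, sub_mulVec, hker Q₁ hQ₁ ht₁ h₁ v hv, hker Q₂ hQ₂ ht₂ h₂ v hv, sub_zero]
  have hEker' : ∀ V : Matrix n n ℂ, G * V = 0 → E * V = 0 := by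
    intro V hV
    ext i j
    have h := hEker (fun k => V k j) (by ext l; exact congrFun (congrFun hV l) j)
    exact congrFun h i
  have hEH : Eᴴ = E := by rw [hE, conjTranspose_sub, hQ₁.1.eq, hQ₂.1.eq]
  -- the midpoint is feasible, so that strict concavity applies
  have hGEG : G * (E * G) = 0 := by
    obtain ⟨A, rfl⟩ := hG.exists_eq_conjTranspose_mul_self
    have hmid : ((2⁻¹ : ℂ) • (Q₁ + Q₂)).PosSemidef := (hQ₁.add hQ₂).smul (by positivity)
    have htr : ((2⁻¹ : ℂ) • (Q₁ + Q₂)).trace.re ≤ p := by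
      have : (2⁻¹ : ℂ) = ((2⁻¹ : ℝ) : ℂ) := by push_cast; rfl
      rw [trace_smul, trace_add, this, smul_eq_mul, Complex.re_ofReal_mul, Complex.add_re]
      linarith
    have h := h₁ _ hmid htr
    have heq := le_antisymm (h₂ _ hQ₁ ht₁) (h₁ _ hQ₂ ht₂)
    simp only [det_one_add_conjTranspose_mul_self_mul] at h heq
    have hsum : (1 + A * Q₁ * Aᴴ) + (1 + A * Q₂ * Aᴴ) =
        (2 : ℂ) • (1 + A * ((2⁻¹ : ℂ) • (Q₁ + Q₂)) * Aᴴ) := by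
      rw [mul_smul_comm, smul_mul_assoc, smul_add, smul_smul, mul_inv_cancel₀ two_ne_zero,
        one_smul, two_smul, mul_add, add_mul]
      abel
    have hXY := PosDef.eq_of_re_det_midpoint_le
      (PosDef.one.add_posSemidef (hQ₁.mul_mul_conjTranspose_same A))
      (PosDef.one.add_posSemidef (hQ₂.mul_mul_conjTranspose_same A)) heq (by
        have h2 : ((2 : ℂ) ^ Fintype.card n) = ((2 ^ Fintype.card n : ℝ) : ℂ) := by push_cast; rfl
        rw [hsum, det_smul, h2, Complex.re_ofReal_mul]
        gcongr)
    have hAEA : A * E * Aᴴ = 0 := by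
      rw [hE, mul_sub, sub_mul, add_left_cancel hXY, sub_self]
    calc Aᴴ * A * (E * (Aᴴ * A)) = Aᴴ * (A * E * Aᴴ) * A := by simp only [mul_assoc]
      _ = 0 := by rw [hAEA, mul_zero, zero_mul]
  have hEG : E * G = 0 := by
    rw [← conjTranspose_mul_self_eq_zero, conjTranspose_mul, hEH, hG.1.eq, mul_assoc,
      hEker' _ hGEG, mul_zero]
  have hGE : G * E = 0 := by
    have := congrArg Matrix.conjTranspose hEG
    rwa [conjTranspose_mul, hEH, hG.1.eq, conjTranspose_zero] at this
  have hEE : E = 0 := by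
    rw [← conjTranspose_mul_self_eq_zero, hEH]
    exact hEker' _ hGE
  exact sub_eq_zero.1 hEE

end Matrix

/-! ### Best responses and Nash equilibria -/

/-- Berge's maximum theorem for unique maximizers, which holds because the graph of the maximizer is
closed. -/
theorem continuous_of_unique_maximizer {X Y : Type*} [TopologicalSpace X] [TopologicalSpace Y]
    [CompactSpace Y] {F : X × Y → ℝ} (hF : Continuous F) {b : X → Y}
    (hb : ∀ x y, F (x, y) ≤ F (x, b x))
    (huniq : ∀ x y, (∀ y', F (x, y') ≤ F (x, y)) → y = b x) : Continuous b := by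
  have hgraph : IsClosed {q : X × Y | ∀ y', F (q.1, y') ≤ F q} := by
    simp only [Set.ofPred_forall]
    exact isClosed_iInter fun y' => isClosed_le (by fun_prop) hF
  refine continuous_iff_isClosed.2 fun s hs => ?_
  convert isClosedMap_fst_of_compactSpace _ (hgraph.inter (hs.preimage continuous_snd)) using 1
  ext x
  simp only [Set.mem_preimage, Set.mem_image, Set.mem_inter_iff, Set.mem_ofPred_eq, Prod.exists,
    exists_and_right, exists_eq_right]
  constructor
  · exact fun h => ⟨b x, hb x, h⟩
  · rintro ⟨y, hy, hys⟩
    rwa [← huniq x y hy]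

namespace FDChannel

variable {M N : ℕ} (C : FDChannel M N)

theorem feasible_nonempty (i : Fin 2) : Nonempty (C.feasible i) :=
  ⟨⟨0, Matrix.PosSemidef.zero, by simpa using C.P_nonneg i⟩⟩

/-- The feasible set is the image under `B ↦ Bᴴ * B` of a Frobenius ball, hence compact. -/
theorem isCompact_feasible (i : Fin 2) : IsCompact (C.feasible i) := by
  have htr : ∀ B : Matrix (Fin M) (Fin M) ℂ, (Bᴴ * B).trace.re = ∑ a, ∑ b, ‖B b a‖ ^ 2 := by
    intro B
    simp only [Matrix.trace, Matrix.diag, Matrix.mul_apply, Matrix.conjTranspose_apply,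
      Complex.re_sum]
    refine Finset.sum_congr rfl fun a _ => Finset.sum_congr rfl fun b _ => ?_
    rw [Complex.star_def, ← Complex.normSq_eq_conj_mul_self, Complex.ofReal_re,
      Complex.normSq_eq_norm_sq]
  have hcpt : IsCompact {B : Matrix (Fin M) (Fin M) ℂ | (Bᴴ * B).trace.re ≤ C.P i} := by
    refine (isCompact_univ_pi fun a => isCompact_univ_pi fun b =>
      isCompact_closedBall (0 : ℂ) (Real.sqrt (C.P i))).of_isClosed_subset ?_ ?_
    · refine isClosed_le (Complex.continuous_re.comp ?_) continuous_const
      exact (continuous_id.matrix_conjTranspose.matrix_mul continuous_id).matrix_trace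
    · intro (B : Matrix (Fin M) (Fin M) ℂ) (hB : (Bᴴ * B).trace.re ≤ C.P i) a _ b _
      rw [htr] at hB
      change B a b ∈ Metric.closedBall 0 _
      rw [mem_closedBall_zero_iff]
      refine Real.le_sqrt_of_sq_le (le_trans ?_ hB)
      refine le_trans ?_ (Finset.single_le_sum (f := fun b => ∑ a, ‖B a b‖ ^ 2)
        (fun b _ => by positivity) (Finset.mem_univ b))
      exact Finset.single_le_sum (f := fun a => ‖B a b‖ ^ 2)
        (fun b _ => by positivity) (Finset.mem_univ a)
  convert hcpt.image (f := fun B => Bᴴ * B)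
    (continuous_id.matrix_conjTranspose.matrix_mul continuous_id)
  ext Q
  constructor
  · rintro ⟨hQ, ht⟩
    obtain ⟨B, rfl⟩ := hQ.exists_eq_conjTranspose_mul_self
    exact ⟨B, ht, rfl⟩
  · rintro ⟨B, hB, rfl⟩
    exact ⟨Matrix.posSemidef_conjTranspose_mul_self B, hB⟩

instance (i : Fin 2) : CompactSpace (C.feasible i) :=
  isCompact_iff_compactSpace.1 (C.isCompact_feasible i)

theorem noiseCov_posDef (j : Fin 2) {Q : Matrix (Fin M) (Fin M) ℂ} (hQ : Q.PosSemidef) :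
    (C.noiseCov j Q).PosDef := by
  refine Matrix.PosDef.one.add_posSemidef (Matrix.PosSemidef.smul ?_ ?_)
  · exact (Matrix.PosSemidef.diagonal fun _ => hQ.diag_nonneg).mul_mul_conjTranspose_same _
  · exact_mod_cast mul_nonneg C.β_nonneg (C.η_nonneg j j)

/-- The Gram matrix of the channel from node `i` to node `j`, whitened by the noise covariance. -/
noncomputable def whitenedGram (i j : Fin 2) (Qj : Matrix (Fin M) (Fin M) ℂ) :
    Matrix (Fin M) (Fin M) ℂ :=
  (C.η i j : ℂ) • ((C.H i j)ᴴ * (C.noiseCov j Qj)⁻¹ * C.H i j)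

theorem rate_eq (i j : Fin 2) (Qi Qj : Matrix (Fin M) (Fin M) ℂ) :
    C.rate i j Qi Qj = Real.log (1 + C.whitenedGram i j Qj * Qi).det.re := by
  rw [rate, whitenedGram, Matrix.smul_mul]

theorem whitenedGram_posSemidef (i j : Fin 2) {Q : Matrix (Fin M) (Fin M) ℂ}
    (hQ : Q.PosSemidef) : (C.whitenedGram i j Q).PosSemidef :=
  ((C.noiseCov_posDef j hQ).inv.posSemidef.conjTranspose_mul_mul_same _).smul
    (by exact_mod_cast C.η_nonneg i j)

theorem whitenedGram_ne_zero {i j : Fin 2} (h : C.η i j ≠ 0 ∧ C.H i j ≠ 0)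
    {Q : Matrix (Fin M) (Fin M) ℂ} (hQ : Q.PosSemidef) : C.whitenedGram i j Q ≠ 0 := by
  intro h0
  rcases smul_eq_zero.1 h0 with h1 | h1
  · exact h.1 (by exact_mod_cast h1)
  · have hpd := (C.noiseCov_posDef j hQ).inv
    obtain ⟨B, hB⟩ := hpd.posSemidef.exists_eq_conjTranspose_mul_self
    have hBH : B * C.H i j = 0 := by
      rw [← Matrix.conjTranspose_mul_self_eq_zero, Matrix.conjTranspose_mul, ← h1, hB]
      simp only [Matrix.mul_assoc]
    have hz : (C.noiseCov j Q)⁻¹ * C.H i j = 0 := by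
      rw [hB, Matrix.mul_assoc, hBH, Matrix.mul_zero]
    have hu : IsUnit (C.noiseCov j Q).det :=
      (Matrix.isUnit_iff_isUnit_det _).1 (C.noiseCov_posDef j hQ).isUnit
    exact h.2 (by rw [← Matrix.mul_nonsing_inv_cancel_left _ (C.H i j) hu, hz, Matrix.mul_zero])

theorem rate_le_rate_iff (i j : Fin 2) {Q Q' Qj : Matrix (Fin M) (Fin M) ℂ} (hQ : Q.PosSemidef)
    (hQ' : Q'.PosSemidef) (hQj : Qj.PosSemidef) :
    C.rate i j Q Qj ≤ C.rate i j Q' Qj ↔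
      (1 + C.whitenedGram i j Qj * Q).det.re ≤ (1 + C.whitenedGram i j Qj * Q').det.re := by
  have hG := C.whitenedGram_posSemidef i j hQj
  rw [rate_eq, rate_eq]
  exact Real.log_le_log_iff (one_pos.trans_le (hG.one_le_re_det_one_add_mul hQ))
    (one_pos.trans_le (hG.one_le_re_det_one_add_mul hQ'))

theorem rate_congr_diag (i j : Fin 2) (Q : Matrix (Fin M) (Fin M) ℂ)
    {Qj Qj' : Matrix (Fin M) (Fin M) ℂ} (h : Qj.diag = Qj'.diag) :
    C.rate i j Q Qj = C.rate i j Q Qj' := by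
  rw [rate, rate, noiseCov, noiseCov, h]

theorem continuous_rate (i j : Fin 2) :
    Continuous fun q : C.feasible j × C.feasible i => C.rate i j q.2 q.1 := by
  have hnoise : Continuous fun q : C.feasible j × C.feasible i => C.noiseCov j q.1 := by
    unfold noiseCov
    fun_prop
  have hinv : Continuous fun q : C.feasible j × C.feasible i => (C.noiseCov j q.1)⁻¹ := by
    simp only [Matrix.inv_def, Ring.inverse_eq_inv']
    exact (hnoise.matrix_det.inv₀ fun q => (C.noiseCov_posDef j q.1.2.1).det_pos.ne').smul
      hnoise.matrix_adjugate
  unfold rate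
  refine Continuous.log (by fun_prop) fun q => ?_
  have := (C.whitenedGram_posSemidef i j q.1.2.1).one_le_re_det_one_add_mul q.2.2.1
  rw [whitenedGram, Matrix.smul_mul] at this
  exact (one_pos.trans_le this).ne'

theorem exists_isBestResponse (i j : Fin 2) : ∃ B, C.IsBestResponse i j B := by
  have h : ∀ Qj : C.feasible j, ∃ B : C.feasible i, ∀ Q ∈ C.feasible i,
      C.rate i j Q Qj ≤ C.rate i j B Qj := by
    intro Qj
    have := C.feasible_nonempty i
    have hpair : Continuous fun Qi : C.feasible i => (Qj, Qi) := by fun_prop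
    have hc := (C.continuous_rate i j).comp hpair
    obtain ⟨B, -, hB⟩ := isCompact_univ.exists_isMaxOn Set.univ_nonempty hc.continuousOn
    exact ⟨B, fun Q hQ => isMaxOn_iff.1 hB ⟨Q, hQ⟩ (Set.mem_univ _)⟩
  choose B hB using h
  exact ⟨B, hB⟩

variable {C}

theorem IsBestResponse.eq_of_isMax {i j : Fin 2} {B : C.feasible j → C.feasible i}
    (hB : C.IsBestResponse i j B) (h : C.η i j ≠ 0 ∧ C.H i j ≠ 0) (Qj : C.feasible j)
    (Qi : C.feasible i) (hQ : ∀ Q ∈ C.feasible i, C.rate i j Q Qj ≤ C.rate i j Qi Qj) :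
    Qi = B Qj :=
  Subtype.ext <| (C.whitenedGram_posSemidef i j Qj.2.1).maximizer_unique
    (C.whitenedGram_ne_zero h Qj.2.1) Qi.2.1 (B Qj).2.1 Qi.2.2 (B Qj).2.2
    (fun Q hQp hQt => (C.rate_le_rate_iff i j hQp Qi.2.1 Qj.2.1).1 (hQ Q ⟨hQp, hQt⟩))
    (fun Q hQp hQt => (C.rate_le_rate_iff i j hQp (B Qj).2.1 Qj.2.1).1 (hB Qj Q ⟨hQp, hQt⟩))

theorem IsBestResponse.unique {i j : Fin 2} {B B' : C.feasible j → C.feasible i}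
    (hB : C.IsBestResponse i j B) (hB' : C.IsBestResponse i j B')
    (h : C.η i j ≠ 0 ∧ C.H i j ≠ 0) : B = B' :=
  funext fun Qj => hB'.eq_of_isMax h Qj (B Qj) (hB Qj)

theorem IsBestResponse.continuous {i j : Fin 2} {B : C.feasible j → C.feasible i}
    (hB : C.IsBestResponse i j B) (h : C.η i j ≠ 0 ∧ C.H i j ≠ 0) : Continuous B :=
  continuous_of_unique_maximizer (C.continuous_rate i j) (fun Qj Qi => hB Qj Qi Qi.2)
    fun Qj Qi hQ => hB.eq_of_isMax h Qj Qi fun Q hQ' => hQ ⟨Q, hQ'⟩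

/-- A best response uses the whole power budget. -/
theorem IsBestResponse.trace_eq {i j : Fin 2} {B : C.feasible j → C.feasible i}
    (hB : C.IsBestResponse i j B) (h : C.η i j ≠ 0 ∧ C.H i j ≠ 0) (Qj : C.feasible j) :
    (B Qj).1.trace.re = C.P i := by
  by_contra hne
  obtain ⟨Q, hQ, ht, hlt⟩ := (C.whitenedGram_posSemidef i j Qj.2.1).exists_re_det_lt
    (C.whitenedGram_ne_zero h Qj.2.1) (B Qj).2.1 (lt_of_le_of_ne (B Qj).2.2 hne)
  exact absurd ((C.rate_le_rate_iff i j hQ (B Qj).2.1 Qj.2.1).1 (hB Qj Q ⟨hQ, ht⟩)) (not_le.2 hlt)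

variable (C)

theorem rate_of_eq_zero {i j : Fin 2} (h : C.η i j = 0 ∨ C.H i j = 0)
    (Q Qj : Matrix (Fin M) (Fin M) ℂ) : C.rate i j Q Qj = 0 := by
  rcases h with h | h <;> simp [rate, h]

theorem subsingleton_feasible {i : Fin 2} (h : C.P i = 0) : Subsingleton (C.feasible i) := by
  suffices H : ∀ Q : C.feasible i, Q.1 = 0 from
    ⟨fun Q Q' => Subtype.ext ((H Q).trans (H Q').symm)⟩
  rintro ⟨Q, hQ, ht⟩
  rw [← hQ.trace_eq_zero_iff]
  have h0 := Complex.nonneg_iff.1 hQ.trace_nonneg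
  exact Complex.ext (le_antisymm (ht.trans h.le) h0.1) h0.2.symm

/-- The feasible covariance matrix that allots the power budget to the antennas in the
proportions `x`. -/
def powerAllocation (i : Fin 2) (x : stdSimplex ℝ (Fin M)) : C.feasible i :=
  ⟨Matrix.diagonal fun k => ((C.P i * x.1 k : ℝ) : ℂ),
    Matrix.PosSemidef.diagonal fun k => by
      simpa only [Pi.zero_apply, Complex.zero_le_real] using mul_nonneg (C.P_nonneg i) (x.2.1 k), by
    rw [Matrix.trace_diagonal, ← Complex.ofReal_sum, Complex.ofReal_re, ← Finset.mul_sum, x.2.2,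
      mul_one]⟩

theorem continuous_powerAllocation (i : Fin 2) : Continuous (C.powerAllocation i) := by
  refine Continuous.subtype_mk (Continuous.matrix_diagonal ?_) _
  exact continuous_pi fun k => Complex.continuous_ofReal.comp
    (continuous_const.mul ((continuous_apply k).comp continuous_subtype_val))

/-- The rate of node `1` depends on the
strategy of node `0` through its diagonal only, which ranges over a simplex, so that
Brouwer's theorem is needed for simplices only. -/
theorem exists_isNashEquilibrium_of_ne_zero (h₀ : C.η 0 1 ≠ 0 ∧ C.H 0 1 ≠ 0)
    (h₁ : C.η 1 0 ≠ 0 ∧ C.H 1 0 ≠ 0) (hP : C.P 0 ≠ 0) : ∃ Q, C.IsNashEquilibrium Q := by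
  obtain ⟨B₁, hB₁⟩ := C.exists_isBestResponse 0 1
  obtain ⟨B₂, hB₂⟩ := C.exists_isBestResponse 1 0
  have hP0 : 0 < C.P 0 := lt_of_le_of_ne (C.P_nonneg 0) hP.symm
  have hne : Nonempty (Fin M) := by
    by_contra hM
    rw [not_nonempty_iff] at hM
    exact h₀.2 (Subsingleton.elim _ _)
  let R : stdSimplex ℝ (Fin M) → C.feasible 0 := fun x => B₁ (B₂ (C.powerAllocation 0 x))
  have hR : Continuous R :=
    (hB₁.continuous h₀).comp ((hB₂.continuous h₁).comp (C.continuous_powerAllocation 0))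
  let f : stdSimplex ℝ (Fin M) → stdSimplex ℝ (Fin M) := fun x =>
    ⟨fun k => ((R x).1 k k).re / C.P 0,
      fun k => div_nonneg (Complex.nonneg_iff.1 (R x).2.1.diag_nonneg).1 hP0.le, by
        have := hB₁.trace_eq h₀ (B₂ (C.powerAllocation 0 x))
        rw [Matrix.trace, Complex.re_sum] at this
        rw [← Finset.sum_div, div_eq_one_iff_eq hP]
        exact this⟩
  have hf : Continuous f := by
    refine Continuous.subtype_mk (continuous_pi fun k => ?_) _
    exact (Complex.continuous_re.comp
      ((continuous_subtype_val.comp hR).matrix_elem k k)).div_const _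
  obtain ⟨x, hx⟩ := exists_fixedPoint_stdSimplex f hf
  have hdiag : (R x).1.diag = (C.powerAllocation 0 x).1.diag := by
    ext k
    have hk : ((R x).1 k k).re / C.P 0 = x.1 k := congrFun (congrArg Subtype.val hx) k
    rw [div_eq_iff hP, mul_comm] at hk
    have hre := (R x).2.1.1.coe_re_apply_self k
    simp only [powerAllocation, Matrix.diag_apply, Matrix.diagonal_apply_eq]
    rw [← hk]
    exact hre.symm
  refine ⟨(R x, B₂ (C.powerAllocation 0 x)), hB₁ _, fun Q hQ => ?_⟩
  have := hB₂ (C.powerAllocation 0 x) Q hQ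
  rwa [C.rate_congr_diag 1 0 Q hdiag, C.rate_congr_diag 1 0 _ hdiag]

theorem exists_isNashEquilibrium : ∃ Q, C.IsNashEquilibrium Q := by
  obtain ⟨B₁, hB₁⟩ := C.exists_isBestResponse 0 1
  obtain ⟨B₂, hB₂⟩ := C.exists_isBestResponse 1 0
  obtain ⟨Q₁⟩ := C.feasible_nonempty 0
  obtain ⟨Q₂⟩ := C.feasible_nonempty 1
  -- a node without a channel or power is indifferent, and only the other node needs to optimize
  by_cases h₀ : C.η 0 1 ≠ 0 ∧ C.H 0 1 ≠ 0
  · by_cases h₁ : C.η 1 0 ≠ 0 ∧ C.H 1 0 ≠ 0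
    · by_cases hP : C.P 0 = 0
      · have := C.subsingleton_feasible hP
        refine ⟨(Q₁, B₂ Q₁), fun Q hQ => ?_, hB₂ Q₁⟩
        rw [show Q = Q₁.1 from congrArg Subtype.val (Subsingleton.elim ⟨Q, hQ⟩ Q₁)]
      · exact C.exists_isNashEquilibrium_of_ne_zero h₀ h₁ hP
    · rw [not_and_or, not_not, not_not] at h₁
      refine ⟨(B₁ Q₂, Q₂), hB₁ Q₂, fun Q hQ => ?_⟩
      rw [C.rate_of_eq_zero h₁, C.rate_of_eq_zero h₁]
  · rw [not_and_or, not_not, not_not] at h₀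
    refine ⟨(Q₁, B₂ Q₁), fun Q hQ => ?_, hB₂ Q₁⟩
    rw [C.rate_of_eq_zero h₀, C.rate_of_eq_zero h₀]

variable {C}

/-- A best-response function may be changed at one point to any other optimal strategy. -/
theorem IsBestResponse.update {i j : Fin 2} [DecidableEq (C.feasible j)]
    {B : C.feasible j → C.feasible i} (hB : C.IsBestResponse i j B) (Qj : C.feasible j) (Qi : C.feasible i)
    (hQ : ∀ Q ∈ C.feasible i, C.rate i j Q Qj ≤ C.rate i j Qi Qj) :
    C.IsBestResponse i j (Function.update B Qj Qi) := by
  intro Q'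
  by_cases h : Q' = Qj
  · subst h
    simpa using hQ
  · simpa [h] using hB Q'

theorem IsNashEquilibrium.exists_isFixedPt {Q : C.feasible 0 × C.feasible 1}
    (hQ : C.IsNashEquilibrium Q) : ∃ Φ, C.IsBestResponseMap Φ ∧ Function.IsFixedPt Φ Q := by
  classical
  obtain ⟨B₁, hB₁⟩ := C.exists_isBestResponse 0 1
  obtain ⟨B₂, hB₂⟩ := C.exists_isBestResponse 1 0
  refine ⟨_, ⟨_, _, hB₁.update Q.2 Q.1 hQ.1, hB₂.update Q.1 Q.2 hQ.2, rfl⟩, ?_⟩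
  simp [Function.IsFixedPt]

theorem IsBestResponseMap.isFixedPt_iff {Φ : C.feasible 0 × C.feasible 1 → _}
    (hΦ : C.IsBestResponseMap Φ) (h₀ : C.η 0 1 ≠ 0 ∧ C.H 0 1 ≠ 0)
    (h₁ : C.η 1 0 ≠ 0 ∧ C.H 1 0 ≠ 0) (Q : C.feasible 0 × C.feasible 1) :
    Function.IsFixedPt Φ Q ↔ C.IsNashEquilibrium Q := by
  obtain ⟨B₁, B₂, hB₁, hB₂, rfl⟩ := hΦ
  constructor
  · intro h
    have h1 : B₁ Q.2 = Q.1 := congrArg Prod.fst h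
    have h2 : B₂ Q.1 = Q.2 := congrArg Prod.snd h
    constructor
    · have := hB₁ Q.2
      rwa [h1] at this
    · have := hB₂ Q.1
      rwa [h2] at this
  · rintro ⟨h1, h2⟩
    exact Prod.ext (hB₁.eq_of_isMax h₀ Q.2 Q.1 h1).symm (hB₂.eq_of_isMax h₁ Q.1 Q.2 h2).symm

end FDChannel

theorem lemma3 {M N : ℕ} (C : FDChannel M N) :
    -- a Nash equilibrium exists
    (∃ Q, C.IsNashEquilibrium Q) ∧
    -- there is a best-response mapping with a fixed point
    (∃ Φ, C.IsBestResponseMap Φ ∧ ∃ Q, Function.IsFixedPt Φ Q) ∧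
    -- if no direct channel vanishes, then the best-response mapping is uniquely determined,
    -- its fixed points are exactly the Nash equilibria, and it has a fixed point
    ((∀ i j, i ≠ j → C.η i j ≠ 0 ∧ C.H i j ≠ 0) →
      (∃! Φ, C.IsBestResponseMap Φ) ∧
      ∀ Φ, C.IsBestResponseMap Φ →
        (∀ Q, Function.IsFixedPt Φ Q ↔ C.IsNashEquilibrium Q) ∧
        ∃ Q, Function.IsFixedPt Φ Q) := by

  obtain ⟨Q, hQ⟩ := C.exists_isNashEquilibrium
  obtain ⟨Φ, hΦ, hfix⟩ := hQ.exists_isFixedPt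
  refine ⟨⟨Q, hQ⟩, ⟨Φ, hΦ, Q, hfix⟩, fun h => ⟨⟨Φ, hΦ, ?_⟩, fun Ψ hΨ => ?_⟩⟩
  · rintro _ ⟨B₁', B₂', hB₁', hB₂', rfl⟩
    obtain ⟨B₁, B₂, hB₁, hB₂, rfl⟩ := hΦ
    rw [hB₁.unique hB₁' (h 0 1 zero_ne_one), hB₂.unique hB₂' (h 1 0 one_ne_zero)]
  · have hiff := hΨ.isFixedPt_iff (h 0 1 zero_ne_one) (h 1 0 one_ne_zero)
    exact ⟨hiff, Q, (hiff Q).2 hQ⟩
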